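/- Let $(L|K,v)$ be an extension of valued fields (of arbitrary rank), with value groups $vK\subseteq vL$. Assume that 1. the completion $\widehat K$ of $(K,v)$ is the maximal immediate extension of $(K,v)$, i.e. $\widehat K$, with the extended valuation, is an immediate extension of $K$ (same value group and same residue field) and itself has no proper immediate extension; 2. $vK$ is cofinal in $vL$. Then the implication (C) $\Rightarrow$ (A) holds, where - (C) $L$ is linearly disjoint over $K$ from every immediate extension $(M,v)$ of $(K,v)$, whenever $L$ and $M$ are both contained in a common valued field extension; - (A) $(L|K,v)$ is vs-defectless: every finitely generated $K$-vector subspace $V\subseteq L$ has a $K$-valuation basis, i.e. a set $B$ of nonzero elements of $L$ that spans $V$ over $K$ and satisfies $v\left(\sum_{i=1}^n c_ib_i\right)=\min_{1\le i\le n} v(c_ib_i)$ for all pairwise distinct $b_1,\dots,b_n\in B$ and all $c_1,\dots,c_n\in K$. -/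

import Mathlib

/-!
Valuations are Mathlib's multiplicative valuations of arbitrary rank: `v x` corresponds to the
additive value with the order reversed, `0` plays the role of `∞`, and `min` becomes `max`.
The value group of `v : Valuation K Γ` is the set of the nonzero values of `v` (not all of `Γ`),
and "`w` extends `v`" is `Valuation.HasExtension v w`: the restriction of `w` is equivalent to `v`.
-/

universe u₁ u₂

/-- `(M, w)` is an immediate extension of `(K, v)`: the valuation `w` extends `v`, and the canonical
embeddings of value groups and of residue fields are onto. -/
class IsImmediateExtension {K M : Type*} [Field K] [Field M] [Algebra K M]
    {Γ Γ' : Type*} [LinearOrderedCommGroupWithZero Γ] [LinearOrderedCommGroupWithZero Γ']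
    (v : Valuation K Γ) (w : Valuation M Γ') : Prop extends v.HasExtension w where
  value_surjective : ∀ y : M, y ≠ 0 → ∃ x : K, w (algebraMap K M x) = w y
  residue_surjective : Function.Surjective
    (algebraMap (IsLocalRing.ResidueField v.valuationSubring)
      (IsLocalRing.ResidueField w.valuationSubring))

/-- `(M, w)` is a maximal valued field: it has no proper immediate extension. (A proper
immediate extension of `M` contains a simple one `M(x)`, which is no larger than `M`, so extensions
living in the universe of `M` suffice.) -/
def IsMaximalValuedField {M : Type u₁} [Field M] {Γ : Type*} [LinearOrderedCommGroupWithZero Γ]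
    (w : Valuation M Γ) : Prop :=
  ∀ (N : Type u₁) [Field N] [Algebra M N] (Δ : Type u₁) [LinearOrderedCommGroupWithZero Δ]
    (w' : Valuation N Δ), IsImmediateExtension w w' → Function.Surjective (algebraMap M N)

/-- `(M, w)` is a maximal immediate extension of `(K, v)`: it is an immediate extension of `(K, v)`,
and it has no proper immediate extension. -/
structure IsMaximalImmediateExtension {K : Type*} {M : Type u₁} [Field K] [Field M] [Algebra K M]
    {Γ Γ' : Type*} [LinearOrderedCommGroupWithZero Γ] [LinearOrderedCommGroupWithZero Γ']
    (v : Valuation K Γ) (w : Valuation M Γ') : Prop where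
  immediate : IsImmediateExtension v w
  maximal : IsMaximalValuedField w

/-- The completion of `(K, v)`, with the extended valuation, is the maximal immediate extension of
`(K, v)`. Here `WithVal v` is `K` with the uniform structure of `v`. -/
def CompletionIsMaximalImmediate {K : Type u₁} [Field K] {Γ : Type*}
    [LinearOrderedCommGroupWithZero Γ] (v : Valuation K Γ) : Prop :=
  IsMaximalImmediateExtension (Valued.v : Valuation (WithVal v) Γ)
    (Valued.v : Valuation v.Completion Γ)

section Extension

variable (K : Type u₁) {L : Type u₂} [Field K] [Field L] [Algebra K L]
  {Γ : Type*} [LinearOrderedCommGroupWithZero Γ]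

/-- The value group of `K` is cofinal in that of `L`: in additive notation, every element of `vL` is
at most some element of `vK`. -/
def ValueGroupCofinal (w : Valuation L Γ) : Prop :=
  ∀ y : L, y ≠ 0 → ∃ x : K, x ≠ 0 ∧ w (algebraMap K L x) ≤ w y

/-- A set `B` of nonzero elements of `L` is `K`-valuation independent: the value of each finite
`K`-linear combination of pairwise distinct elements of `B` is the smallest value (additively) of
its terms. -/
def IsValuationIndependent (w : Valuation L Γ) (B : Set L) : Prop :=
  (0 : L) ∉ B ∧ ∀ (s : Finset L), (s : Set L) ⊆ B → ∀ c : L → K,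
    w (∑ b ∈ s, c b • b) = s.sup fun b => w (c b • b)

/-- `B` is a `K`-valuation basis of the `K`-subspace `V` of `L`. -/
def IsValuationBasis (w : Valuation L Γ) (V : Submodule K L) (B : Set L) : Prop :=
  IsValuationIndependent K w B ∧ Submodule.span K B = V

/-- The extension `(L|K, w)` is vs-defectless. -/
def IsVSDefectless (w : Valuation L Γ) : Prop :=
  ∀ V : Submodule K L, V.FG → ∃ B : Set L, IsValuationBasis K w V B

end Extension

/-- `L` is linearly disjoint over `K` from every immediate extension `M` of `K`, whenever the valued
fields `L` and `M` are contained in a common valued field extension `(Ω, w)`. The valuation on `M` is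
then the restriction of `w`. (All of this may be tested inside the compositum of `L` and `M`, whose
cardinality is at most `2 ^ #L` when `L` is infinite, so `Ω` may be taken in the universe of `L`.) -/
def LinearlyDisjointFromImmediate {K : Type u₁} {L : Type u₂} [Field K] [Field L] [Algebra K L]
    {Γ Γ' : Type*} [LinearOrderedCommGroupWithZero Γ] [LinearOrderedCommGroupWithZero Γ']
    (vK : Valuation K Γ) (vL : Valuation L Γ') : Prop :=
  ∀ (Ω : Type u₂) [Field Ω] [Algebra K Ω] [Algebra L Ω] [IsScalarTower K L Ω]
    (Δ : Type u₂) [LinearOrderedCommGroupWithZero Δ] (w : Valuation Ω Δ),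
    vL.HasExtension w → ∀ M : IntermediateField K Ω,
      IsImmediateExtension vK (w.comap (algebraMap M Ω)) → M.LinearDisjoint L

/-! Let `F` be the completion of `K` and `Ω` that of `L`. By Kaplansky's theorem
(`IsMaximalValuedField.sphericallyComplete`) `F` is spherically complete. Cofinality makes `K → L`
continuous, so `F` maps into `Ω`; by density of `K` the image is an immediate extension of `K`, and
(C) keeps `K`-independent vectors of `L` independent over `F`. Over a spherically complete field,
subtracting best approximations works like Gram-Schmidt and turns such vectors into a valuation
independent family in their `F`-span. Moving the coefficients from `F` to nearby elements of `K`
changes each member by less than its own value, which preserves independence, and the new family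
lies in `L`. For Kaplansky's theorem, a chain of balls with empty intersection acquires a common
point in an ultrapower. A common point `y` of least degree over `F` in the algebraic closure, or any
one if none is algebraic, generates an immediate extension `F(y)`: nonzero polynomial values at `y`
are approximated by values at centres of balls. Maximality forces `y` into `F`, a contradiction. -/

/-! ### Approximation with small relative error, and immediate extensions. -/

/-- The relation `v (a - b) < v b` means that `a / b` is a 1-unit. As 1-units form a group, it
passes to products and inverses, hence from polynomials in `y` to all of `F(y)`. -/
theorem Valuation.mul_sub_mul_lt {R Γ : Type*} [CommRing R] [LinearOrderedCommGroupWithZero Γ]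
    (v : Valuation R Γ) {a b a' b' : R} (h : v (a - b) < v b) (h' : v (a' - b') < v b') :
    v (a * a' - b * b') < v (b * b') := by
  have ha : v a = v b := v.map_eq_of_sub_lt h
  have hb : 0 < v b := zero_le.trans_lt h
  have hb' : 0 < v b' := zero_le.trans_lt h'
  have e : a * a' - b * b' = a * (a' - b') + (a - b) * b' := by ring
  rw [e, map_mul]
  refine v.map_add_lt ?_ ?_
  · rw [map_mul, ha]
    exact mul_lt_mul_of_pos_left h' hb
  · rw [map_mul]
    exact mul_lt_mul_of_pos_right h hb'

theorem Valuation.inv_sub_inv_lt {F Γ : Type*} [Field F] [LinearOrderedCommGroupWithZero Γ]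
    (v : Valuation F Γ) {a b : F} (h : v (a - b) < v b) :
    v (a⁻¹ - b⁻¹) < v b⁻¹ := by
  have ha : v a = v b := v.map_eq_of_sub_lt h
  have hb : 0 < v b := zero_le.trans_lt h
  have hb0 : b ≠ 0 := (v.pos_iff).1 hb
  have ha0 : a ≠ 0 := (v.pos_iff).1 (ha ▸ hb)
  have e : a⁻¹ - b⁻¹ = (b - a) * (a⁻¹ * b⁻¹) := by field_simp
  have e' : b⁻¹ = b * (b⁻¹ * b⁻¹) := by field_simp
  rw [e]
  conv_rhs => rw [e']
  rw [map_mul, map_mul, map_mul, map_mul, v.map_sub_swap, map_inv₀, map_inv₀, ha]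
  exact mul_lt_mul_of_pos_right h (mul_pos (inv_pos.2 hb) (inv_pos.2 hb))

/-- An extension in which every nonzero element is close to an element of the base field is
immediate. -/
theorem IsImmediateExtension.of_forall_exists_sub_lt {K M : Type*} [Field K] [Field M] [Algebra K M]
    {Γ Γ' : Type*} [LinearOrderedCommGroupWithZero Γ] [LinearOrderedCommGroupWithZero Γ']
    {v : Valuation K Γ} {w : Valuation M Γ'} (hext : v.HasExtension w)
    (h : ∀ y : M, y ≠ 0 → ∃ k : K, w (y - algebraMap K M k) < w (algebraMap K M k)) :
    IsImmediateExtension v w := by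
  refine { hext with value_surjective := ?_, residue_surjective := ?_ }
  · intro y hy
    obtain ⟨k, hk⟩ := h y hy
    exact ⟨k, (w.map_eq_of_sub_lt hk).symm⟩
  · intro r
    obtain ⟨⟨y, hy⟩, rfl⟩ := IsLocalRing.residue_surjective r
    by_cases hy0 : y = 0
    · subst hy0
      exact ⟨0, by rw [map_zero]; exact (map_zero (IsLocalRing.residue _)).symm⟩
    obtain ⟨k, hk⟩ := h y hy0
    have hyk := w.map_eq_of_sub_lt hk
    have hy1 : w y ≤ 1 := hy
    have hk1 : k ∈ v.valuationSubring := (Valuation.HasExtension.val_map_le_one_iff v w k).1 (hyk ▸ hy1)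
    refine ⟨IsLocalRing.residue _ ⟨k, hk1⟩, ?_⟩
    rw [Valuation.HasExtension.algebraMap_residue_eq_residue_algebraMap, ← sub_eq_zero, ← map_sub,
      IsLocalRing.residue_eq_zero_iff, IsLocalRing.mem_maximalIdeal, mem_nonunits_iff]
    intro hu
    obtain ⟨⟨t, ht⟩, hut⟩ := hu.exists_right_inv
    have hut' : (algebraMap K M k - y) * t = 1 := congrArg Subtype.val hut
    have ht1 : w t ≤ 1 := ht
    have h1 : w ((algebraMap K M k - y) * t) < 1 := by
      rw [map_mul, w.map_sub_swap]
      exact mul_lt_one_of_lt_of_le (hk.trans_le (hyk ▸ hy1)) ht1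
    rw [hut', map_one] at h1
    exact lt_irrefl _ h1

/-! ### Spherical completeness and Kaplansky's theorem. -/

/-- A valuation on a field `F` is spherically complete if every chain of ultrametric balls
`c i + D i` has a common point. The sets `D i` are the balls around `0`, given without radii as
lower sets for the valuation. -/
def Valuation.SphericallyComplete {F : Type u₁} [Field F] {Γ : Type*}
    [LinearOrderedCommGroupWithZero Γ] (v : Valuation F Γ) : Prop :=
  ∀ (ι : Type u₁) (c : ι → F) (D : ι → Set F), (∀ i, 0 ∈ D i) →
    (∀ i x y, x ∈ D i → v y ≤ v x → y ∈ D i) →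
    (∀ i j, c i - c j ∈ D i ∨ c i - c j ∈ D j) → ∃ a, ∀ i, a - c i ∈ D i

/-- The valuation ring of an ultrapower. -/
def Valuation.germValuationSubring {α F Γ : Type*} [Field F] [LinearOrderedCommGroupWithZero Γ]
    (v : Valuation F Γ) (l : Ultrafilter α) : ValuationSubring (Filter.Germ (l : Filter α) F) where
  carrier := {g | g.LiftPred fun x => v x ≤ 1}
  mul_mem' {a b} := by
    induction a using Filter.Germ.inductionOn with | _ f
    induction b using Filter.Germ.inductionOn with | _ g
    intro hf hg
    have hf : ∀ᶠ x in (l : Filter α), v (f x) ≤ 1 := hf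
    have hg : ∀ᶠ x in (l : Filter α), v (g x) ≤ 1 := hg
    change ∀ᶠ x in (l : Filter α), v (f x * g x) ≤ 1
    filter_upwards [hf, hg] with x h h'
    rw [map_mul]
    exact mul_le_one' h h'
  one_mem' := by
    change ∀ᶠ x in (l : Filter α), v (1 : F) ≤ 1
    simp
  add_mem' {a b} := by
    induction a using Filter.Germ.inductionOn with | _ f
    induction b using Filter.Germ.inductionOn with | _ g
    intro hf hg
    have hf : ∀ᶠ x in (l : Filter α), v (f x) ≤ 1 := hf
    have hg : ∀ᶠ x in (l : Filter α), v (g x) ≤ 1 := hg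
    change ∀ᶠ x in (l : Filter α), v (f x + g x) ≤ 1
    filter_upwards [hf, hg] with x h h'
    exact v.map_add_le h h'
  zero_mem' := by
    change ∀ᶠ x in (l : Filter α), v (0 : F) ≤ 1
    simp
  neg_mem' {a} := by
    induction a using Filter.Germ.inductionOn with | _ f
    intro hf
    have hf : ∀ᶠ x in (l : Filter α), v (f x) ≤ 1 := hf
    change ∀ᶠ x in (l : Filter α), v (- f x) ≤ 1
    simpa using hf
  mem_or_inv_mem' a := by
    induction a using Filter.Germ.inductionOn with | _ f
    change (∀ᶠ x in (l : Filter α), v (f x) ≤ 1) ∨ (∀ᶠ x in (l : Filter α), v ((f x)⁻¹) ≤ 1)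
    rw [← Ultrafilter.eventually_or]
    refine Filter.Eventually.of_forall fun x => ?_
    rw [map_inv₀]
    rcases le_total (v (f x)) 1 with h | h
    · exact Or.inl h
    · exact Or.inr (inv_le_one_of_one_le₀ h)

/-- Some valuation ring of `Ω` dominates the image of `A`. If `x ∉ A` landed in it, the non-unit
`x⁻¹` of `A` would become a unit, against domination. -/
theorem ValuationSubring.exists_comap_eq {E Ω : Type*} [Field E] [Field Ω] (A : ValuationSubring E)
    (f : E →+* Ω) : ∃ B : ValuationSubring Ω, B.comap f = A := by
  obtain ⟨B, hB, hloc⟩ := IsLocalRing.exists_factor_valuationRing (f.comp A.subtype)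
  refine ⟨B, le_antisymm (fun x hx => ?_) (fun x hx => hB ⟨x, hx⟩)⟩
  by_contra hxA
  have hx0 : x ≠ 0 := fun h => hxA (h ▸ A.zero_mem)
  have hinv : x⁻¹ ∈ A := (A.mem_or_inv_mem x).resolve_left hxA
  have hu : IsUnit (((f.comp A.subtype).codRestrict B.toSubring hB) ⟨x⁻¹, hinv⟩) := by
    refine IsUnit.of_mul_eq_one ⟨f x, hx⟩ (Subtype.ext ?_)
    change f x⁻¹ * f x = 1
    rw [← map_mul, inv_mul_cancel₀ hx0, map_one]
  obtain ⟨u, hu⟩ := hloc.map_nonunit _ hu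
  apply hxA
  have : (x⁻¹) * ((u⁻¹ : Aˣ) : A) = 1 := by
    have h : ((u : A) : E) = x⁻¹ := congrArg Subtype.val hu
    rw [← h]
    exact congrArg Subtype.val u.mul_inv
  have h2 : (((u⁻¹ : Aˣ) : A) : E) = x := by
    field_simp at this
    exact this
  rw [← h2]
  exact Subtype.property _

/-- A chain of balls without common point in `F` has a common point in an algebraically closed
valued extension field of `F`. -/
theorem Valuation.exists_isAlgClosed_extension_common_point {F : Type u₁} [Field F] {Γ : Type*}
    [LinearOrderedCommGroupWithZero Γ] (v : Valuation F Γ) {ι : Type u₁} (c : ι → F)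
    (D : ι → Set F) (h0 : ∀ i, 0 ∈ D i) (hD : ∀ i x y, x ∈ D i → v y ≤ v x → y ∈ D i)
    (hc : ∀ i j, c i - c j ∈ D i ∨ c i - c j ∈ D j) (hno : ¬∃ a, ∀ i, a - c i ∈ D i) :
    ∃ (Ω : Type u₁) (_ : Field Ω) (_ : Algebra F Ω) (_ : IsAlgClosed Ω) (B : ValuationSubring Ω),
      v.HasExtension B.valuation ∧ ∃ x : Ω, ∀ i, ∃ z ∈ D i,
        B.valuation (x - algebraMap F Ω (c i)) ≤ B.valuation (algebraMap F Ω z) := by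
  classical
  push Not at hno
  have hadd : ∀ i x y, x ∈ D i → y ∈ D i → x + y ∈ D i := fun i x y hx hy => by
    rcases le_max_iff.1 (v.map_add x y) with h | h
    · exact hD i _ _ hx h
    · exact hD i _ _ hy h
  have htot : ∀ i j, D i ⊆ D j ∨ D j ⊆ D i := fun i j => by
    by_cases h : D i ⊆ D j
    · exact Or.inl h
    · obtain ⟨x, hx, hxj⟩ := Set.not_subset.1 h
      exact Or.inr fun y hy => hD i x y hx
        (le_of_not_ge fun h' => hxj (hD j y x hy h'))
  have hneg : ∀ i x y, x - y ∈ D i → y - x ∈ D i := fun i x y h =>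
    hD i _ _ h (v.map_sub_swap y x).le
  let S : ι → Set F := fun i => {u | u - c i ∈ D i}
  have hS : ∀ i j, D i ⊆ D j → S i ⊆ S j := fun i j hij u hu => by
    have h1 : c i - c j ∈ D j := (hc i j).elim (fun h => hij h) id
    have h2 := hadd j _ _ (hij hu) h1
    rwa [sub_add_sub_cancel] at h2
  have hdir : Directed (· ≥ ·) fun i => Filter.principal (S i) := fun i j => by
    rcases htot i j with h | h
    · exact ⟨i, le_rfl, Filter.principal_mono.2 (hS i j h)⟩
    · exact ⟨j, Filter.principal_mono.2 (hS j i h), le_rfl⟩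
  obtain ⟨i₀, -⟩ := hno 0
  have : Nonempty ι := ⟨i₀⟩
  have : (⨅ i, Filter.principal (S i)).NeBot :=
    Filter.iInf_neBot_of_directed hdir fun i =>
      Filter.principal_neBot_iff.2 ⟨c i, by simpa [S] using h0 i⟩
  -- The ultrafilter contains every ball, so the germ of the identity will be the common point.
  let l : Ultrafilter F := Ultrafilter.of (⨅ i, Filter.principal (S i))
  have hl : ∀ i, ∀ᶠ u in (l : Filter F), u - c i ∈ D i := fun i =>
    Ultrafilter.of_le _ (Filter.mem_iInf_of_mem i (Filter.mem_principal_self (S i)))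
  let E := Filter.Germ (l : Filter F) F
  let A : ValuationSubring E := v.germValuationSubring l
  let f : F →+* E :=
    { toFun := fun a => (Filter.Germ.const a : E)
      map_one' := rfl
      map_mul' := fun _ _ => rfl
      map_zero' := rfl
      map_add' := fun _ _ => rfl }
  let g : E →+* AlgebraicClosure E := algebraMap E (AlgebraicClosure E)
  obtain ⟨B, hB⟩ := A.exists_comap_eq g
  have hBA : ∀ e : E, B.valuation (g e) ≤ 1 ↔ e ∈ A := fun e => by
    rw [B.valuation_le_one_iff, ← hB, ValuationSubring.mem_comap]
  have hBE : ∀ p q : F → F, (∀ᶠ u in (l : Filter F), v (p u) ≤ v (q u)) →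
      B.valuation (g (p : E)) ≤ B.valuation (g (q : E)) := fun p q hpq => by
    by_cases hq : ((q : E)) = 0
    · have hq' : ∀ᶠ u in (l : Filter F), q u = 0 := Filter.Germ.coe_eq.1 hq
      have hp : (p : E) = 0 := Filter.Germ.coe_eq.2 (by
        filter_upwards [hpq, hq'] with u h h'
        rw [h', map_zero, le_zero_iff, v.zero_iff] at h
        exact h)
      rw [hp, hq]
    · have hq' : B.valuation (g (q : E)) ≠ 0 := by
        rw [Valuation.ne_zero_iff]
        exact (map_ne_zero g).2 hq
      rw [← div_le_one₀ (zero_lt_iff.2 hq'), ← map_div₀, ← map_div₀, hBA]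
      change ∀ᶠ u in (l : Filter F), v (p u / q u) ≤ 1
      filter_upwards [hpq] with u h
      rw [map_div₀]
      exact div_le_one_of_le₀ h zero_le
  let _ : Algebra F (AlgebraicClosure E) := (g.comp f).toAlgebra
  refine ⟨AlgebraicClosure E, inferInstance, inferInstance, inferInstance, B, ⟨?_⟩,
    g ((id : F → F) : E), fun i => ?_⟩
  · rw [Valuation.isEquiv_iff_val_le_one]
    intro x
    change v x ≤ 1 ↔ B.valuation (g (f x)) ≤ 1
    rw [hBA]
    change v x ≤ 1 ↔ ∀ᶠ u in (l : Filter F), v x ≤ 1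
    rw [Filter.eventually_const]
  -- `D i` has no radius to compare with. A smaller ball `j` missing `c i` supplies one: all its
  -- points are within `v (c i - c j)` of `c i`.
  · obtain ⟨j, hj⟩ := hno (c i)
    have hij : D j ⊆ D i := (htot i j).resolve_left fun h =>
      hj ((hc i j).elim (fun h' => h h') id)
    have hji : c i - c j ∈ D i := (hc i j).resolve_right hj
    refine ⟨c i - c j, hji, ?_⟩
    have := hBE (fun u => u - c i) (fun _ => c i - c j) ?_
    · have e : g ((id : F → F) : E) - algebraMap F (AlgebraicClosure E) (c i)
          = g ((fun u : F => u - c i : F → F) : E) := by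
        change g _ - g (f (c i)) = _
        rw [← _root_.map_sub]
        rfl
      rw [e]
      exact this
    · filter_upwards [hl j] with u hu
      have h1 : v (u - c j) ≤ v (c i - c j) := le_of_not_ge fun h => hj (hD j _ _ hu h)
      have e : u - c i = (u - c j) - (c i - c j) := by ring
      rw [e]
      exact (v.map_sub _ _).trans (max_le h1 le_rfl)

/-- **Kaplansky**: a valued field without proper immediate extensions is spherically complete. -/
theorem IsMaximalValuedField.sphericallyComplete {F : Type u₁} [Field F] {Γ : Type*}
    [LinearOrderedCommGroupWithZero Γ] {v : Valuation F Γ} (hv : IsMaximalValuedField v) :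
    v.SphericallyComplete := by
  classical
  intro ι c D h0 hD hc
  by_contra hno
  obtain ⟨Ω, _, _, _, B, hext, x, hx⟩ :=
    v.exists_isAlgClosed_extension_common_point c D h0 hD hc hno
  push Not at hno
  let w := B.valuation
  let φ := algebraMap F Ω
  let P : Ω → Prop := fun y => ∀ i, ∃ z ∈ D i, w (y - φ (c i)) ≤ w (φ z)
  have hFP : ∀ a : F, ¬ P (φ a) := fun a ha => by
    obtain ⟨i, hi⟩ := hno a
    obtain ⟨z, hz, hza⟩ := ha i
    rw [← map_sub] at hza
    exact hi (hD i z _ hz ((Valuation.HasExtension.val_map_le_iff v w _ _).1 hza))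
  have htot : ∀ i j, D i ⊆ D j ∨ D j ⊆ D i := fun i j => by
    by_cases h : D i ⊆ D j
    · exact Or.inl h
    · obtain ⟨x, hx, hxj⟩ := Set.not_subset.1 h
      exact Or.inr fun y hy => hD i x y hx
        (le_of_not_ge fun h' => hxj (hD j y x hy h'))
  -- an element outside of one of the balls stays outside of the smaller ones
  have hmono : ∀ (s : Ω) (i j : ι), D j ⊆ D i → (∀ z ∈ D i, w (φ z) < w (s - φ (c i))) →
      ∀ z ∈ D j, w (φ z) < w (s - φ (c j)) := fun s i j hij hs z hz => by
    have h1 : c j - c i ∈ D i := (hc j i).elim (fun h => hij h) id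
    have h2 := hs _ h1
    rw [map_sub] at h2
    have e : s - φ (c j) = (s - φ (c i)) - (φ (c j) - φ (c i)) := by ring
    rw [e, w.map_sub_eq_of_lt_left h2]
    exact hs z (hij hz)
  -- The balls form a chain, so a single one excludes any finite set of non-common points.
  have hfin : ∀ m : Multiset Ω, (∀ s ∈ m, ¬ P s) →
      ∃ i, ∀ s ∈ m, ∀ z ∈ D i, w (φ z) < w (s - φ (c i)) := by
    intro m
    induction m using Multiset.induction_on with
    | empty => exact fun _ => ⟨(hno 0).choose, by simp⟩
    | cons s m ih =>
      intro hm
      obtain ⟨i, hi⟩ := ih fun s hs => hm s (Multiset.mem_cons_of_mem hs)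
      have hs := hm s (Multiset.mem_cons_self s m)
      simp only [P, not_forall, not_exists, not_and, not_le] at hs
      obtain ⟨j, hj⟩ := hs
      rcases htot i j with h | h
      · refine ⟨i, fun t ht => ?_⟩
        rcases Multiset.mem_cons.1 ht with rfl | ht
        · exact hmono _ _ _ h hj
        · exact hi t ht
      · refine ⟨j, fun t ht => ?_⟩
        rcases Multiset.mem_cons.1 ht with rfl | ht
        · exact hj
        · exact hmono _ _ _ h (hi t ht)
  have hprod : ∀ (y : Ω) (a : F) (m : Multiset Ω),
      (∀ s ∈ m, w ((y - s) - (φ a - s)) < w (φ a - s)) →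
      w ((m.map fun s => y - s).prod - (m.map fun s => φ a - s).prod)
        < w (m.map fun s => φ a - s).prod := by
    intro y a m
    induction m using Multiset.induction_on with
    | empty => intro _; simp
    | cons s m ih =>
      intro hm
      rw [Multiset.map_cons, Multiset.map_cons, Multiset.prod_cons, Multiset.prod_cons]
      exact w.mul_sub_mul_lt (hm s (Multiset.mem_cons_self s m))
        (ih fun s hs => hm s (Multiset.mem_cons_of_mem hs))
  -- In a ball excluding every root `s`, each factor `y - s` is close to `c i - s`; multiplying,
  -- `f(y)` is close to `f(c i)`.
  have hpoly : ∀ (y : Ω), P y → ∀ f : Polynomial F, f ≠ 0 → (∀ s ∈ f.aroots Ω, ¬ P s) →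
      ∃ k : F, w (Polynomial.aeval y f - φ k) < w (φ k) := by
    intro y hy f hf hr
    obtain ⟨i, hi⟩ := hfin _ hr
    obtain ⟨z, hz, hyz⟩ := hy i
    refine ⟨f.eval (c i), ?_⟩
    have hsp : ∀ t : Ω, Polynomial.aeval t f =
        φ f.leadingCoeff * ((f.aroots Ω).map fun s => t - s).prod := fun t =>
      (IsAlgClosed.splits (f.map φ)).aeval_eq_prod_aroots t
    have e : φ (f.eval (c i)) = Polynomial.aeval (φ (c i)) f := by
      rw [Polynomial.aeval_algebraMap_apply_eq_algebraMap_eval]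
    rw [e, hsp, hsp]
    refine w.mul_sub_mul_lt ?_ (hprod y (c i) _ fun s hs => ?_)
    · rw [sub_self, map_zero, zero_lt_iff, Valuation.ne_zero_iff]
      exact (map_ne_zero φ).2 (Polynomial.leadingCoeff_ne_zero.2 hf)
    · rw [sub_sub_sub_cancel_right, w.map_sub_swap (φ (c i)) s]
      exact hyz.trans_lt (hi s hs z hz)
  -- a common point of the balls generating an immediate extension
  obtain ⟨y, hy, hyr⟩ : ∃ y, P y ∧ ∀ f : Polynomial F, Polynomial.aeval y f ≠ 0 →
      ∃ k : F, w (Polynomial.aeval y f - φ k) < w (φ k) := by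
    by_cases halg : ∃ n : ℕ, ∃ y, P y ∧ IsIntegral F y ∧ (minpoly F y).natDegree = n
    · obtain ⟨y, hy, hint, hn⟩ := Nat.find_spec halg
      refine ⟨y, hy, fun f hf => ?_⟩
      -- The remainder has the same value at `y` and degree below the minimum, so none of its roots
      -- is a common point.
      rw [← Polynomial.modByMonic_add_div f (minpoly F y), map_add, map_mul, minpoly.aeval,
        zero_mul, add_zero] at hf ⊢
      set r := f %ₘ minpoly F y
      have hr0 : r ≠ 0 := fun h => hf (by rw [h, map_zero])
      refine hpoly y hy r hr0 fun s hs hPs => ?_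
      have hsr : Polynomial.aeval s r = 0 := (Polynomial.mem_aroots.1 hs).2
      have hsint : IsIntegral F s := IsAlgebraic.isIntegral ⟨r, hr0, hsr⟩
      refine Nat.find_min halg (m := (minpoly F s).natDegree) ?_ ⟨s, hPs, hsint, rfl⟩
      rw [← hn]
      calc (minpoly F s).natDegree ≤ r.natDegree :=
            Polynomial.natDegree_le_of_dvd (minpoly.dvd F s hsr) hr0
        _ < (minpoly F y).natDegree :=
            Polynomial.natDegree_modByMonic_lt f (minpoly.monic hint) (minpoly.ne_one F y)
    · refine ⟨x, hx, fun f hf => hpoly x hx f (fun h => hf (by rw [h, map_zero])) ?_⟩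
      intro s hs hPs
      have hf0 : f ≠ 0 := fun h => hf (by rw [h, map_zero])
      exact halg ⟨_, s, hPs, IsAlgebraic.isIntegral ⟨f, hf0, (Polynomial.mem_aroots.1 hs).2⟩, rfl⟩
  let N := IntermediateField.adjoin F {y}
  have himm : IsImmediateExtension v (w.comap (algebraMap N Ω)) := by
    refine .of_forall_exists_sub_lt ⟨?_⟩ ?_
    · exact hext.val_isEquiv_comap
    · rintro ⟨z, hz⟩ hz0
      have hz0' : z ≠ 0 := fun h => hz0 (Subtype.ext h)
      obtain ⟨p, q, rfl⟩ := (IntermediateField.mem_adjoin_simple_iff F z).1 hz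
      obtain ⟨hp, hq⟩ := div_ne_zero_iff.1 hz0'
      obtain ⟨k, hk⟩ := hyr p hp
      obtain ⟨k', hk'⟩ := hyr q hq
      refine ⟨k * k'⁻¹, ?_⟩
      change w (Polynomial.aeval y p / Polynomial.aeval y q - φ (k * k'⁻¹)) < w (φ (k * k'⁻¹))
      rw [map_mul, map_inv₀, div_eq_mul_inv]
      exact w.mul_sub_mul_lt hk (w.inv_sub_inv_lt hk')
  obtain ⟨a, ha⟩ := hv N _ _ himm ⟨y, IntermediateField.mem_adjoin_simple_self F y⟩
  have ha' : φ a = y := congrArg Subtype.val ha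
  exact hFP a (ha' ▸ hy)

/-! ### Valuation independent families and best approximation. -/

/-- A family of vectors over a valued field `F`, in a valued field extension of `F`, for which the
value of a linear combination is the largest value of its terms. -/
def Valuation.IsIndependentFamily (F : Type*) {Ω Γ ι : Type*} [Field F] [Field Ω] [Algebra F Ω]
    [LinearOrderedCommGroupWithZero Γ] [Fintype ι] (w : Valuation Ω Γ) (b : ι → Ω) : Prop :=
  (∀ i, b i ≠ 0) ∧ ∀ (c : ι → F) (i : ι), w (c i • b i) ≤ w (∑ j, c j • b j)

section

variable {F Ω Γ ι : Type*} [Field F] [Field Ω] [Algebra F Ω] [LinearOrderedCommGroupWithZero Γ]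
  [Fintype ι] {w : Valuation Ω Γ} {b : ι → Ω}

theorem Valuation.IsIndependentFamily.linearIndependent (hb : w.IsIndependentFamily F b) :
    LinearIndependent F b := by
  rw [Fintype.linearIndependent_iff]
  intro c hc i
  have h := hb.2 c i
  rw [hc, map_zero, le_zero_iff, w.zero_iff, smul_eq_zero] at h
  exact h.resolve_right (hb.1 i)

/-- Moving each member of an independent family a little keeps it independent. -/
theorem Valuation.IsIndependentFamily.of_sub_lt (hb : w.IsIndependentFamily F b) {b' : ι → Ω}
    (h : ∀ i, w (b' i - b i) < w (b i)) : w.IsIndependentFamily F b' := by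
  have hval : ∀ i, w (b' i) = w (b i) := fun i => w.map_eq_of_sub_lt (h i)
  refine ⟨fun i hi => ?_, fun c i => ?_⟩
  · have := hval i
    rw [hi, map_zero, eq_comm, w.zero_iff] at this
    exact hb.1 i this
  · have hci : ∀ j, w (c j • b' j) = w (c j • b j) := fun j => by
      rw [Algebra.smul_def, Algebra.smul_def, map_mul, map_mul, hval]
    rw [hci]
    by_cases h0 : w (∑ j, c j • b j) = 0
    · exact ((hb.2 c i).trans h0.le).trans zero_le
    -- Each term moves by less than its own value, hence by less than the whole sum, which dominates
    -- its terms.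
    have hlt : w (∑ j, c j • b' j - ∑ j, c j • b j) < w (∑ j, c j • b j) := by
      rw [← Finset.sum_sub_distrib]
      refine w.map_sum_lt h0 fun j _ => ?_
      rw [← smul_sub, Algebra.smul_def, map_mul]
      by_cases hc : w (algebraMap F Ω (c j)) = 0
      · rw [hc, zero_mul]
        exact zero_lt_iff.2 h0
      · refine (mul_lt_mul_of_pos_left (h j) (zero_lt_iff.2 hc)).trans_le ?_
        rw [← map_mul, ← Algebra.smul_def]
        exact hb.2 c j
    rw [w.map_eq_of_sub_lt hlt]
    exact hb.2 c i

end

/-- Over a spherically complete field, the span of an independent family contains a best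
approximation of every element. -/
theorem Valuation.SphericallyComplete.exists_best_approx {F : Type u₁} {Ω Γ Γ' : Type*}
    [Field F] [Field Ω] [Algebra F Ω]
    [LinearOrderedCommGroupWithZero Γ] [LinearOrderedCommGroupWithZero Γ'] {v : Valuation F Γ}
    {w : Valuation Ω Γ'} [v.HasExtension w] (hv : v.SphericallyComplete) {n : ℕ} {b : Fin n → Ω}
    (hb : w.IsIndependentFamily F b) (x : Ω) :
    ∃ a : Fin n → F, ∀ c : Fin n → F,
      w (x - ∑ i, a i • b i) ≤ w (x - ∑ i, c i • b i) := by
  -- For each coordinate `i`, every tuple `c` gives a ball about `c i` whose size is the error of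
  -- `c`. Two tuples differ by at most the larger error, and independence passes this bound to
  -- coordinates, so the balls form a chain.
  have key : ∀ i : Fin n, ∃ a : F, ∀ c : ULift.{u₁} (Fin n) → F,
      w ((a - c ⟨i⟩) • b i) ≤ w (x - ∑ j : Fin n, c ⟨j⟩ • b j) := by
    intro i
    have := hv (ULift.{u₁} (Fin n) → F) (fun c => c ⟨i⟩)
      (fun c => {z | w (z • b i) ≤ w (x - ∑ j : Fin n, c ⟨j⟩ • b j)}) (fun c => by simp) ?_ ?_
    · exact this
    · intro c y z hy hyz
      refine le_trans ?_ hy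
      rw [Algebra.smul_def, Algebra.smul_def, map_mul, map_mul]
      gcongr
      exact (Valuation.HasExtension.val_map_le_iff v w _ _).2 hyz
    · intro c c'
      refine le_max_iff.1 ?_
      refine (hb.2 (fun j : Fin n => c ⟨j⟩ - c' ⟨j⟩) i).trans ?_
      have e : ∑ j : Fin n, (c ⟨j⟩ - c' ⟨j⟩) • b j =
          (x - ∑ j : Fin n, c' ⟨j⟩ • b j) - (x - ∑ j : Fin n, c ⟨j⟩ • b j) := by
        simp only [sub_smul, Finset.sum_sub_distrib]
        ring
      rw [e, max_comm]
      exact w.map_sub _ _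
  choose a ha using key
  refine ⟨a, fun c => ?_⟩
  have hac : ∀ i, w ((a i - c i) • b i) ≤ w (x - ∑ j, c j • b j) := fun i => by
    simpa using ha i fun m => c m.down
  have e : x - ∑ i, a i • b i = (x - ∑ i, c i • b i) - ∑ i, (a i - c i) • b i := by
    simp only [sub_smul, Finset.sum_sub_distrib]
    ring
  rw [e]
  exact (w.map_sub _ _).trans (max_le le_rfl (w.map_sum_le fun i _ => hac i))

/-- Over a spherically complete field, the span of a linearly independent family is spanned by an
independent family for the valuation. -/
theorem Valuation.SphericallyComplete.exists_isIndependentFamily {F : Type u₁} {Ω Γ Γ' : Type*}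
    [Field F] [Field Ω] [Algebra F Ω]
    [LinearOrderedCommGroupWithZero Γ] [LinearOrderedCommGroupWithZero Γ'] {v : Valuation F Γ}
    {w : Valuation Ω Γ'} [v.HasExtension w] (hv : v.SphericallyComplete) {n : ℕ} (x : Fin n → Ω)
    (hx : LinearIndependent F x) :
    ∃ b : Fin n → Ω, w.IsIndependentFamily F b ∧
      ∀ i, b i ∈ Submodule.span F (Set.range x) := by
  induction n with
  | zero => exact ⟨x, ⟨fun i => i.elim0, fun _ i => i.elim0⟩, fun i => i.elim0⟩
  | succ n ih =>
    obtain ⟨hx', hlast⟩ := linearIndependent_finSucc'.1 hx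
    obtain ⟨b, hb, hbx⟩ := ih _ hx'
    obtain ⟨a, ha⟩ := hv.exists_best_approx hb (x (Fin.last n))
    set y := x (Fin.last n) - ∑ i, a i • b i with hy
    have hmem : ∀ c : Fin n → F,
        ∑ i, c i • b i ∈ Submodule.span F (Set.range (Fin.init x)) := fun c =>
      Submodule.sum_mem _ fun i _ => Submodule.smul_mem _ _ (hbx i)
    have hy0 : y ≠ 0 := fun h => hlast (by
      rw [sub_eq_zero.1 h]
      exact hmem a)
    have hsub : Submodule.span F (Set.range (Fin.init x)) ≤ Submodule.span F (Set.range x) :=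
      Submodule.span_mono (by rintro _ ⟨i, rfl⟩; exact ⟨_, rfl⟩)
    -- Minimality of the remainder `y` is the orthogonality needed to adjoin it to `b`.
    have hyc : ∀ c : Fin n → F, w y ≤ w (y + ∑ i, c i • b i) := fun c => by
      have e : y + ∑ i, c i • b i = x (Fin.last n) - ∑ i, (a i - c i) • b i := by
        simp only [hy, sub_smul, Finset.sum_sub_distrib]
        ring
      rw [e]
      exact ha _
    refine ⟨Fin.snoc b y, ⟨fun i => ?_, fun c i => ?_⟩, fun i => ?_⟩
    · refine Fin.lastCases ?_ (fun j => ?_) i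
      · simpa using hy0
      · simpa using hb.1 j
    · rw [Fin.sum_univ_castSucc]
      simp only [Fin.snoc_castSucc, Fin.snoc_last]
      set t := c (Fin.last n)
      set s := ∑ j : Fin n, c j.castSucc • b j
      have hlast' : w (t • y) ≤ w (s + t • y) := by
        by_cases ht : t = 0
        · simp [ht]
        · have e : s + t • y = t • (y + ∑ j : Fin n, (t⁻¹ * c j.castSucc) • b j) := by
            rw [smul_add, Finset.smul_sum, add_comm]
            congr 1
            refine Finset.sum_congr rfl fun j _ => ?_
            rw [smul_smul, mul_inv_cancel_left₀ ht]
          rw [e, Algebra.smul_def, Algebra.smul_def, map_mul, map_mul]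
          gcongr
          exact hyc _
      refine Fin.lastCases ?_ (fun j => ?_) i
      · simpa using hlast'
      · simp only [Fin.snoc_castSucc]
        refine (hb.2 (fun j => c j.castSucc) j).trans ?_
        have e : s = (s + t • y) - t • y := by ring
        change w s ≤ _
        rw [e, sub_add_cancel]
        exact (w.map_sub _ _).trans (max_le le_rfl hlast')
    · refine Fin.lastCases ?_ (fun j => ?_) i
      · rw [Fin.snoc_last]
        exact Submodule.sub_mem _ (Submodule.subset_span ⟨_, rfl⟩) (hsub (hmem a))
      · rw [Fin.snoc_castSucc]
        exact hsub (hbx j)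

/-- If the members of a basis of each finitely generated subspace can be replaced by an independent
family for the valuation, then the extension is vs-defectless. -/
theorem IsVSDefectless.of_exists_isIndependentFamily {K L Γ : Type*} [Field K] [Field L]
    [Algebra K L] [LinearOrderedCommGroupWithZero Γ] {w : Valuation L Γ}
    (h : ∀ (n : ℕ) (x : Fin n → L), LinearIndependent K x →
      ∃ b : Fin n → L, w.IsIndependentFamily K b ∧ ∀ i, b i ∈ Submodule.span K (Set.range x)) :
    IsVSDefectless K w := by
  classical
  intro V hV
  have : Module.Finite K V := Module.Finite.iff_fg.2 hV
  let e := Module.finBasis K V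
  have hli : LinearIndependent K fun i => (e i : L) :=
    e.linearIndependent.map' V.subtype (Submodule.ker_subtype V)
  have hspan : Submodule.span K (Set.range fun i => (e i : L)) = V := by
    have : (Set.range fun i => (e i : L)) = V.subtype '' Set.range e := by
      rw [← Set.range_comp]; rfl
    rw [this, Submodule.span_image, e.span_eq, Submodule.map_subtype_top]
  obtain ⟨b, hb, hbV⟩ := h _ _ hli
  rw [hspan] at hbV
  refine ⟨Set.range b, ⟨?_, fun s hs c => ?_⟩, ?_⟩
  · rintro ⟨i, hi⟩
    exact hb.1 i hi
  · have hinj := hb.linearIndependent.injective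
    let d : Fin (Module.finrank K V) → K := fun i => if b i ∈ s then c (b i) else 0
    have hsum : ∑ i, d i • b i = ∑ y ∈ s, c y • y := by
      have hs' : s = (Finset.univ.filter fun i => b i ∈ s).image b := by
        ext y
        simp only [Finset.mem_image, Finset.mem_filter, Finset.mem_univ, true_and]
        constructor
        · intro hy
          obtain ⟨i, rfl⟩ := hs hy
          exact ⟨i, hy, rfl⟩
        · rintro ⟨i, hi, rfl⟩
          exact hi
      conv_rhs => rw [hs']
      rw [Finset.sum_image hinj.injOn, Finset.sum_filter]
      refine Finset.sum_congr rfl fun i _ => ?_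
      by_cases hi : b i ∈ s <;> simp [d, hi]
    refine le_antisymm (w.map_sum_le fun y hy =>
      Finset.le_sup (f := fun y => w (c y • y)) hy) (Finset.sup_le fun y hy => ?_)
    obtain ⟨i, rfl⟩ := hs hy
    have hy' : b i ∈ s := hy
    have := hb.2 d i
    rw [hsum] at this
    simpa [d, hy'] using this
  · refine Submodule.eq_of_le_of_finrank_eq (Submodule.span_le.2 ?_) ?_
    · rintro _ ⟨i, rfl⟩
      exact hbV i
    · rw [finrank_span_eq_card hb.linearIndependent, Fintype.card_fin]

/-! ### Descent from the completion to the base field. -/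

/-- Descent of valuation bases from a spherically complete field in which the base field is
dense. -/
theorem IsVSDefectless.of_sphericallyComplete {K L Ω : Type*} {F : Type u₁} [Field K] [Field L]
    [Field F] [Field Ω] [Algebra K L] [Algebra K F] [Algebra K Ω] [Algebra L Ω] [Algebra F Ω]
    [IsScalarTower K L Ω] [IsScalarTower K F Ω] {Γ Γ' Γ'' : Type*}
    [LinearOrderedCommGroupWithZero Γ] [LinearOrderedCommGroupWithZero Γ']
    [LinearOrderedCommGroupWithZero Γ'']
    {vL : Valuation L Γ} {v : Valuation F Γ'} {w : Valuation Ω Γ''} [vL.HasExtension w]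
    [v.HasExtension w] (hv : v.SphericallyComplete)
    (hdense : ∀ (z : F) (y : Ω), y ≠ 0 →
      ∃ k : K, w (algebraMap F Ω z - algebraMap K Ω k) < w y)
    (hlin : ∀ (n : ℕ) (x : Fin n → L), LinearIndependent K x →
      LinearIndependent F fun i => algebraMap L Ω (x i)) :
    IsVSDefectless K vL := by
  refine .of_exists_isIndependentFamily fun n x hx => ?_
  obtain ⟨b, hb, hbx⟩ := hv.exists_isIndependentFamily (w := w) _ (hlin n x hx)
  have happrox : ∀ i, ∃ y ∈ Submodule.span K (Set.range x),
      w (algebraMap L Ω y - b i) < w (b i) := fun i => by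
    obtain ⟨c, hc⟩ := (Submodule.mem_span_range_iff_exists_fun F).1 (hbx i)
    have hk : ∀ j, ∃ k : K,
        w ((algebraMap F Ω (c j) - algebraMap K Ω k) * algebraMap L Ω (x j)) < w (b i) := by
      intro j
      have hxj : algebraMap L Ω (x j) ≠ 0 := by
        simpa using hx.ne_zero j
      -- After multiplication by `x j`, this precision makes the error smaller than `b i`.
      obtain ⟨k, hk⟩ := hdense (c j) (b i / algebraMap L Ω (x j)) (div_ne_zero (hb.1 i) hxj)
      refine ⟨k, ?_⟩
      rw [map_div₀] at hk
      rw [map_mul]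
      exact (lt_div_iff₀ (zero_lt_iff.2 (w.ne_zero_iff.2 hxj))).1 hk
    choose k hk using hk
    refine ⟨∑ j, k j • x j, Submodule.sum_mem _ fun j _ =>
      Submodule.smul_mem _ _ (Submodule.subset_span ⟨j, rfl⟩), ?_⟩
    rw [w.map_sub_swap, ← hc, map_sum, ← Finset.sum_sub_distrib]
    refine w.map_sum_lt (by rw [hc]; exact w.ne_zero_iff.2 (hb.1 i)) fun j _ => ?_
    have e : c j • algebraMap L Ω (x j) - algebraMap L Ω (k j • x j) =
        (algebraMap F Ω (c j) - algebraMap K Ω (k j)) * algebraMap L Ω (x j) := by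
      rw [Algebra.smul_def, Algebra.smul_def, map_mul, ← IsScalarTower.algebraMap_apply, sub_mul]
    rw [e, hc]
    exact hk j
  choose y hyx hyb using happrox
  refine ⟨y, ?_, hyx⟩
  have hy := hb.of_sub_lt hyb
  refine ⟨fun i hi => hy.1 i (by simp [hi]), fun c i => ?_⟩
  rw [← Valuation.HasExtension.val_map_le_iff vL w, map_sum]
  have e : ∀ j, algebraMap L Ω (c j • y j) = algebraMap K F (c j) • algebraMap L Ω (y j) := by
    intro j
    rw [Algebra.smul_def, Algebra.smul_def, map_mul, ← IsScalarTower.algebraMap_apply,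
      ← IsScalarTower.algebraMap_apply]
  simp only [e]
  exact hy.2 (fun j => algebraMap K F (c j)) i

/-! ### Completions and the conclusion. -/

/-- An extension of valued fields is continuous if the value group of the base is cofinal. -/
theorem ValueGroupCofinal.continuous_map {K : Type u₁} {L : Type u₂} [Field K] [Field L]
    [Algebra K L] {Γ Γ' : Type*} [LinearOrderedCommGroupWithZero Γ]
    [LinearOrderedCommGroupWithZero Γ'] (vK : Valuation K Γ) (vL : Valuation L Γ')
    [vK.HasExtension vL] (hcof : ValueGroupCofinal K vL) :
    Continuous (WithVal.map vK vL (algebraMap K L)) := by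
  refine continuous_of_continuousAt_zero _ ?_
  rw [ContinuousAt, map_zero]
  intro s hs
  rw [Valued.mem_nhds_zero] at hs
  obtain ⟨γ, hγ⟩ := hs
  obtain ⟨⟨y⟩, hy⟩ := MonoidWithZeroHom.ValueGroup₀.restrict₀_surjective
    (f := .ofClass (Valued.v : Valuation (WithVal vL) Γ')) γ.1
  have hy0 : y ≠ 0 := by
    rintro rfl
    exact γ.ne_zero (hy ▸ map_zero (Valued.v : Valuation (WithVal vL) Γ').restrict)
  obtain ⟨x, hx0, hxy⟩ := hcof y hy0
  rw [Filter.mem_map, Valued.mem_nhds_zero]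
  refine ⟨Units.mk0 ((Valued.v : Valuation (WithVal vK) Γ).restrict (WithVal.toVal vK x))
    ((Valuation.ne_zero_iff _).2 fun h => hx0 (congrArg WithVal.ofVal h)), fun z hz => hγ ?_⟩
  have hz' : vK z.ofVal < vK x :=
    (Valuation.restrict_lt_iff (Valued.v : Valuation (WithVal vK) Γ)).1 hz
  change Valued.v.restrict _ < γ.1
  rw [← hy, ← Valuation.restrict_def, Valuation.restrict_lt_iff]
  change vL (algebraMap K L z.ofVal) < vL y
  exact ((Valuation.HasExtension.val_map_lt_iff vK vL _ _).2 hz').trans_le hxy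

/-- In a valued field, balls with radius in the value group are neighborhoods of their center. -/
theorem Valued.setOf_v_sub_lt_mem_nhds {R Γ : Type*} [Field R] [LinearOrderedCommGroupWithZero Γ]
    [Valued R Γ] (a : R) {y : R} (hy : y ≠ 0) :
    {x : R | (Valued.v : Valuation R Γ) (x - a) < Valued.v y} ∈ nhds a := by
  rw [Valued.mem_nhds]
  refine ⟨Units.mk0 ((Valued.v : Valuation R Γ).restrict y) ((Valuation.ne_zero_iff _).2 hy),
    fun z hz => ?_⟩
  exact (Valuation.restrict_lt_iff _).1 hz

/-- The criterion for vs-defectlessness, for a dense immediate spherically complete extension `F`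
of `K` which lies together with `L` in a valued field `Ω`. -/
theorem LinearlyDisjointFromImmediate.isVSDefectless {K F : Type u₁} {L Ω : Type u₂} [Field K]
    [Field L] [Field F] [Field Ω] [Algebra K L] {Γ Γ' : Type*} [LinearOrderedCommGroupWithZero Γ]
    [LinearOrderedCommGroupWithZero Γ'] {vK : Valuation K Γ} {vL : Valuation L Γ'}
    (hC : LinearlyDisjointFromImmediate vK vL) (hext : vK.HasExtension vL)
    {v : Valuation F Γ} {w₀ : Valuation Ω Γ'} (hv : v.SphericallyComplete)
    (iK : K →+* F) (iL : L →+* Ω) (g : F →+* Ω) (hcomm : ∀ k, g (iK k) = iL (algebraMap K L k))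
    (hvK : ∀ x, v (iK x) = vK x) (hwL : ∀ x, w₀ (iL x) = vL x)
    (hdense₀ : ∀ (z a : F) (y : Ω), a ≠ 0 → y ≠ 0 →
      ∃ k : K, v (iK k - z) < v a ∧ w₀ (g (iK k) - g z) < w₀ y) :
    IsVSDefectless K vL := by
  let _ : Algebra K F := iK.toAlgebra
  let _ : Algebra L Ω := iL.toAlgebra
  let _ : Algebra F Ω := g.toAlgebra
  let _ : Algebra K Ω := (iL.comp (algebraMap K L)).toAlgebra
  have : IsScalarTower K L Ω := IsScalarTower.of_algebraMap_eq fun _ => rfl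
  have : IsScalarTower K F Ω := IsScalarTower.of_algebraMap_eq fun k => (hcomm k).symm
  -- (C) quantifies over value groups in the universe of `L`; the canonical value group of the
  -- valuation ring lives there.
  let w := w₀.valuationSubring.valuation
  have hw : w₀.IsEquiv w := w₀.isEquiv_valuation_valuationSubring
  have hLw : vL.HasExtension w := ⟨by
    refine Valuation.IsEquiv.trans (Valuation.IsEquiv.of_eq ?_) (hw.comap iL)
    ext x
    exact (hwL x).symm⟩
  have hdense₂ : ∀ (z a : F) (y : Ω), a ≠ 0 → y ≠ 0 →
      ∃ k : K, v (iK k - z) < v a ∧ w (g z - g (iK k)) < w y := fun z a y ha hy => by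
    obtain ⟨k, hk1, hk2⟩ := hdense₀ z a y ha hy
    exact ⟨k, hk1, hw.lt_iff_lt.1 (by rwa [Valuation.map_sub_swap])⟩
  have hdense : ∀ (z : F) (y : Ω), y ≠ 0 →
      ∃ k : K, w (algebraMap F Ω z - algebraMap K Ω k) < w y := fun z y hy => by
    obtain ⟨k, -, hk⟩ := hdense₂ z 1 y one_ne_zero hy
    refine ⟨k, ?_⟩
    rw [IsScalarTower.algebraMap_apply K F Ω]
    exact hk
  have hKw : vK.HasExtension w := ⟨by
    refine hext.val_isEquiv_comap.trans ?_
    exact hLw.val_isEquiv_comap.comap (algebraMap K L)⟩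
  -- An element `k` close to `z` for both valuations has the same values as `z`, so comparing `v`
  -- with `w` on `F` reduces to `K`.
  have hnear : ∀ z : F, z ≠ 0 → ∃ k : K, v z = vK k ∧ w (g z - g (iK k)) < w (g (iK k)) ∧
      w (g z) = w (algebraMap K Ω k) := fun z hz => by
    obtain ⟨k, hk1, hk2⟩ := hdense₂ z z (g z) hz ((map_ne_zero g).2 hz)
    have e : w (g (iK k)) = w (g z) := w.map_eq_of_sub_lt (by rwa [w.map_sub_swap])
    refine ⟨k, ?_, e ▸ hk2, ?_⟩
    · rw [← hvK, v.map_eq_of_sub_lt hk1]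
    · rw [← e, hcomm]
      rfl
  have hFw : v.HasExtension w := ⟨by
    rw [Valuation.isEquiv_iff_val_le_one]
    intro z
    by_cases hz : z = 0
    · simp [hz]
    obtain ⟨k, h1, -, h2⟩ := hnear z hz
    rw [Valuation.comap_apply, h1]
    change _ ↔ w (g z) ≤ 1
    rw [h2, Valuation.HasExtension.val_map_le_one_iff vK w]⟩
  -- the image of the completion of `K` is an immediate extension inside the completion of `L`
  let φ : F →ₐ[K] Ω := IsScalarTower.toAlgHom K F Ω
  let M : IntermediateField K Ω := φ.fieldRange
  have hM : IsImmediateExtension vK (w.comap (algebraMap M Ω)) := by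
    refine .of_forall_exists_sub_lt ⟨hKw.val_isEquiv_comap⟩ ?_
    rintro ⟨_, z, rfl⟩ hz
    have hz0 : z ≠ 0 := by
      rintro rfl
      exact hz (Subtype.ext (map_zero φ))
    obtain ⟨k, -, hk, -⟩ := hnear z hz0
    rw [hcomm] at hk
    exact ⟨k, hk⟩
  have hdisj := hC Ω w₀.valuationSubring.ValueGroup w hLw M hM
  refine .of_sphericallyComplete (w := w) (v := v) hv hdense
    fun n x hx => ?_
  have hxM := hdisj.linearIndependent_right' hx
  rw [Fintype.linearIndependent_iff] at hxM ⊢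
  intro c hc i
  have := hxM (fun i => ⟨φ (c i), c i, rfl⟩) (by
    simp only [Algebra.smul_def] at hc ⊢
    exact hc) i
  exact (map_eq_zero φ).1 (congrArg Subtype.val this)

theorem theorem4p4 {K : Type u₁} {L : Type u₂} [Field K] [Field L] [Algebra K L]
    {Γ Γ' : Type*} [LinearOrderedCommGroupWithZero Γ] [LinearOrderedCommGroupWithZero Γ']
    (vK : Valuation K Γ) (vL : Valuation L Γ') (hext : vK.HasExtension vL)
    (hcompl : CompletionIsMaximalImmediate vK)
    (hcof : ValueGroupCofinal K vL)
    (hC : LinearlyDisjointFromImmediate vK vL) :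
    IsVSDefectless K vL := by
  let F := vK.Completion
  let Ω := vL.Completion
  let f := WithVal.map vK vL (algebraMap K L)
  have hf : Continuous f := hcof.continuous_map vK vL
  let iK : K →+* F :=
    (UniformSpace.Completion.coeRingHom : WithVal vK →+* F).comp (WithVal.equiv vK).symm.toRingHom
  let iL : L →+* Ω :=
    (UniformSpace.Completion.coeRingHom : WithVal vL →+* Ω).comp (WithVal.equiv vL).symm.toRingHom
  let g : F →+* Ω := UniformSpace.Completion.mapRingHom f hf
  have hg : Continuous g := UniformSpace.Completion.continuous_map
  have hcomm : ∀ k : K, g (iK k) = iL (algebraMap K L k) := fun k =>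
    UniformSpace.Completion.mapRingHom_coe hf (WithVal.toVal vK k)
  refine hC.isVSDefectless hext (v := (Valued.v : Valuation F Γ)) (w₀ := (Valued.v : Valuation Ω Γ'))
    hcompl.maximal.sphericallyComplete iK iL g hcomm
    (fun x => Valued.extensionValuation_apply_coe (WithVal.toVal vK x))
    (fun x => Valued.extensionValuation_apply_coe (WithVal.toVal vL x)) fun z a y ha hy => ?_
  have h1 := Valued.setOf_v_sub_lt_mem_nhds (Γ := Γ) z ha
  -- Continuity of `g` lets one element of `K` approximate `z` in `F` and `g z` in `Ω` at once.
  have h2 := hg.continuousAt.preimage_mem_nhds (Valued.setOf_v_sub_lt_mem_nhds (Γ := Γ') (g z) hy)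
  obtain ⟨k, hk1, hk2⟩ :=
    UniformSpace.Completion.denseRange_coe.mem_nhds (Filter.inter_mem h1 h2)
  exact ⟨k.ofVal, hk1, hk2⟩
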